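/- Let $R$ be a ring with identity. A unital twisted partial action of $\mathbb Z$ on $R$ is a triple $\alpha=(\{D_i\}_{i\in\mathbb Z},\{\alpha_i\}_{i\in\mathbb Z},\{w_{i,j}\}_{i,j\in\mathbb Z})$, where $D_i$ is a two-sided ideal of $R$ generated by a central idempotent $1_i$, $\alpha_i:D_{-i}\to D_i$ is a ring isomorphism, and $w_{i,j}$ is an invertible element of the ring $D_iD_{i+j}$ (with identity $1_i1_{i+j}$), such that for all $i,j,k\in\mathbb Z$: $D_0=R$ and $\alpha_0=\mathrm{id}_R$; $\alpha_i(D_{-i}D_j)=D_iD_{i+j}$; $\alpha_i(\alpha_j(a))=w_{i,j}\,\alpha_{i+j}(a)\,w_{i,j}^{-1}$ for $a\in D_{-j}D_{-(i+j)}$; $w_{i,0}=w_{0,i}=1_i$; and $\alpha_i(a w_{j,k})w_{i,j+k}=\alpha_i(a)w_{i,j}w_{i+j,k}$ for $a\in D_{-i}D_jD_{j+k}$. The ring $R[[x;\alpha,w]]$ consists of the formal series $\sum_{n\ge 0}a_nx^n$ with $a_n\in D_n$, with coefficientwise addition and the multiplication given by $(ax^i)(bx^j)=\alpha_i(\alpha_i^{-1}(a)b)\,w_{i,j}\,x^{i+j}$.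 A twisted global action of $\mathbb Z$ on a (not necessarily unital) associative ring $T$ consists of ring automorphisms $\beta_i$ of $T$ and invertible multipliers $u_{i,j}$ of $T$ such that, for all $i,j,k\in\mathbb Z$ and $a\in T$: $\beta_0=\mathrm{id}_T$; $\beta_i(\beta_j(a))=u_{i,j}\beta_{i+j}(a)u_{i,j}^{-1}$; $u_{i,0}=u_{0,i}=1$; and $\beta_i(au_{j,k})u_{i,j+k}=\beta_i(a)u_{i,j}u_{i+j,k}$. The ring $T[[x;\beta,u]]$ consists of the formal series $\sum_{n\ge0}a_nx^n$ with $a_n\in T$, with $(ax^i)(bx^j)=\beta_i(\beta_i^{-1}(a)b)\,u_{i,j}\,x^{i+j}$. Suppose that $(T,\beta,u)$ is an enveloping action of $(R,\alpha,w)$ via an injective ring homomorphism $\varphi:R\to T$; that is, for all $i,j\in\mathbb Z$: $\varphi(R)$ is a two-sided ideal of $T$; $T=\sum_{i\in\mathbb Z}\beta_i(\varphi(R))$; $\varphi(D_i)=\varphi(R)\cap\beta_i(\varphi(R))$; $\varphi(\alpha_i(a))=\beta_i(\varphi(a))$ for $a\in D_{-i}$; and $\varphi(aw_{i,j})=\varphi(a)u_{i,j}$,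 $\varphi(w_{i,j}a)=u_{i,j}\varphi(a)$ for $a\in D_iD_{i+j}$. Regard $R[[x;\alpha,w]]$ as a subring of $T[[x;\beta,u]]$ via $\sum a_nx^n\mapsto\sum\varphi(a_n)x^n$, and $R$ as the set of constant series $\varphi(r)x^0$. Then the contraction $P'\mapsto P'\cap R[[x;\alpha,w]]$ is a bijection from the set of all prime ideals $P'$ of $T[[x;\beta,u]]$ with $R\not\subseteq P'$ onto the set of all prime ideals of $R[[x;\alpha,w]]$. Here a prime ideal of a ring is a proper two-sided ideal $P$ such that, for two-sided ideals $I,J$, $IJ\subseteq P$ implies $I\subseteq P$ or $J\subseteq P$. -/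

import Mathlib

/-- A unital twisted partial action of `ℤ` on a unital ring `R`: ideals `D i` generated by central
idempotents `e i`, ring isomorphisms `α i : D (-i) → D i`, and elements `w i j` which are invertible
in `D i * D (i + j)` (with inverse `winv i j`). A product of ideals generated by central
idempotents is their intersection, so products `D i * D j` are written as intersections. -/
structure TwistedPartialAction (R : Type*) [Ring R] where
  D : ℤ → TwoSidedIdeal R
  e : ℤ → R
  e_idem : ∀ i, e i * e i = e i
  e_central : ∀ i r, e i * r = r * e i
  D_eq_span : ∀ i, D i = TwoSidedIdeal.span {e i}
  α : ∀ i, D (-i) ≃+* D i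
  w : ℤ → ℤ → R
  winv : ℤ → ℤ → R
  w_mem : ∀ i j, w i j ∈ D i ∧ w i j ∈ D (i + j)
  winv_mem : ∀ i j, winv i j ∈ D i ∧ winv i j ∈ D (i + j)
  w_mul_winv : ∀ i j, w i j * winv i j = e i * e (i + j)
  winv_mul_w : ∀ i j, winv i j * w i j = e i * e (i + j)
  D_zero : D 0 = ⊤
  α_zero : ∀ a : D (-0), (α 0 a : R) = a
  α_image : ∀ i j, (fun a : D (-i) => (α i a : R)) '' {a | (a : R) ∈ D j} =
    {b | b ∈ D i ∧ b ∈ D (i + j)}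
  /-- `α i (α j a) = w i j * α (i + j) a * (w i j)⁻¹` for `a ∈ D (-j) * D (-(i + j))`
  (the membership `h` is automatic). -/
  α_comp : ∀ i j (a : R) (h₁ : a ∈ D (-j)) (h₂ : a ∈ D (-(i + j)))
    (h : (α j ⟨a, h₁⟩ : R) ∈ D (-i)),
    (α i ⟨(α j ⟨a, h₁⟩ : R), h⟩ : R) = w i j * (α (i + j) ⟨a, h₂⟩ : R) * winv i j
  w_right_zero : ∀ i, w i 0 = e i
  w_left_zero : ∀ i, w 0 i = e i
  /-- The cocycle identity, for `a ∈ D (-i) * D j * D (j + k)`. -/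
  cocycle : ∀ i j k (a : R) (h : a ∈ D (-i)), a ∈ D j → a ∈ D (j + k) →
    (α i ⟨a * w j k, (D (-i)).mul_mem_right _ _ h⟩ : R) * w i (j + k) =
      (α i ⟨a, h⟩ : R) * w i j * w (i + j) k

namespace TwistedPartialAction

variable {R : Type*} [Ring R] (A : TwistedPartialAction R)

theorem mem_D {i : ℤ} {a : R} : a ∈ A.D i ↔ a * A.e i = a := by
  constructor
  · intro h
    rw [A.D_eq_span] at h
    induction h using TwoSidedIdeal.span_induction with
    | mem x h => rw [Set.mem_singleton_iff.1 h, A.e_idem]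
    | zero => simp
    | add x y _ _ hx hy => rw [add_mul, hx, hy]
    | neg x _ hx => rw [neg_mul, hx]
    | left_absorb a x _ hx => rw [mul_assoc, hx]
    | right_absorb b x _ hx => rw [mul_assoc, ← A.e_central, ← mul_assoc, hx]
  · intro h
    rw [← h, A.D_eq_span]
    exact TwoSidedIdeal.mul_mem_left _ _ _ (TwoSidedIdeal.subset_span rfl)

theorem e_mem (i : ℤ) : A.e i ∈ A.D i := A.mem_D.2 (A.e_idem i)

theorem e_zero : A.e 0 = 1 := by
  have h : (1 : R) ∈ A.D 0 := by rw [A.D_zero]; trivial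
  simpa using A.mem_D.1 h

theorem α_mem {i j : ℤ} {a : A.D (-i)} (h : (a : R) ∈ A.D j) : (A.α i a : R) ∈ A.D (i + j) := by
  have : (A.α i a : R) ∈ {b | b ∈ A.D i ∧ b ∈ A.D (i + j)} := by
    rw [← A.α_image]; exact ⟨a, h, rfl⟩
  exact this.2

/-- The coefficient of `(a x^i) (b x^j)`, namely `α_i (α_i⁻¹ (a) b) w_{i,j}`. -/
def monoMul (i j : ℤ) (a : A.D i) (b : R) : R :=
  (A.α i ⟨((A.α i).symm a : R) * b, (A.D (-i)).mul_mem_right _ _ ((A.α i).symm a).2⟩ : R) * A.w i j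

theorem monoMul_mem (i j : ℤ) (a : A.D i) (b : R) : A.monoMul i j a b ∈ A.D (i + j) :=
  (A.D _).mul_mem_left _ _ (A.w_mem i j).2

/-- The extension `r ↦ α_i (r 1_{-i})` of `α_i` to `R`. -/
def act (i : ℤ) (r : R) : R := (A.α i ⟨A.e (-i) * r, (A.D _).mul_mem_right _ _ (A.e_mem _)⟩ : R)

theorem act_add (i : ℤ) (r s : R) : A.act i (r + s) = A.act i r + A.act i s := by
  unfold act
  rw [← AddMemClass.coe_add, ← map_add]
  congr 3
  simp [mul_add]

theorem act_mul (i : ℤ) (r s : R) : A.act i (r * s) = A.act i r * A.act i s := by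
  unfold act
  rw [← MulMemClass.coe_mul, ← map_mul]
  congr 2
  apply Subtype.ext
  simp only [MulMemClass.coe_mul]
  rw [mul_assoc, ← mul_assoc r, ← A.e_central, ← mul_assoc, ← mul_assoc, ← mul_assoc,
    A.e_idem]

theorem α_eq_act {i : ℤ} (a : A.D (-i)) : (A.α i a : R) = A.act i a := by
  unfold act
  congr 2
  apply Subtype.ext
  simp only
  rw [A.e_central, A.mem_D.1 a.2]

theorem act_mem (i : ℤ) (r : R) : A.act i r ∈ A.D i := (A.α i _).2

theorem act_mem_add (i : ℤ) {j : ℤ} {r : R} (h : r ∈ A.D j) : A.act i r ∈ A.D (i + j) :=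
  A.α_mem ((A.D j).mul_mem_left _ _ h)

theorem monoMul_eq (i j : ℤ) (a : A.D i) (b : R) :
    A.monoMul i j a b = a * A.act i b * A.w i j := by
  unfold monoMul
  rw [α_eq_act, act_mul, ← α_eq_act, RingEquiv.apply_symm_apply]

theorem act_zero' (i : ℤ) : A.act i 0 = 0 := by
  have := A.act_add i 0 0
  simpa using this

theorem act_eq_mul_e (i : ℤ) (r : R) : A.act i (A.e (-i) * r) = A.act i r := by
  unfold act
  congr 3
  rw [← mul_assoc, A.e_idem]

theorem act_comp (i j : ℤ) (c : R) :
    A.act i (A.act j c) * A.w i j = A.w i j * A.act (i + j) c := by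
  have key : ∀ b : R, b ∈ A.D (-j) → b ∈ A.D (-(i + j)) →
      A.act i (A.act j b) * A.w i j = A.w i j * A.act (i + j) b := by
    intro b h₁ h₂
    have h : (A.α j ⟨b, h₁⟩ : R) ∈ A.D (-i) := by
      have := A.α_mem (i := j) (j := -(i + j)) (a := ⟨b, h₁⟩) h₂
      have h' : j + -(i + j) = -i := by ring
      rwa [h'] at this
    have := A.α_comp i j b h₁ h₂ h
    rw [A.α_eq_act, A.α_eq_act, A.α_eq_act] at this
    simp only at this
    rw [this, mul_assoc, A.winv_mul_w]
    have h3 : A.act (i + j) b * A.e i = A.act (i + j) b := by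
      rw [← A.mem_D]
      have := A.act_mem_add (i + j) h₁
      simpa using this
    have h4 := A.mem_D.1 (A.act_mem (i + j) b)
    rw [mul_assoc, ← mul_assoc (A.act (i + j) b), h3, h4]
  have hw1 := A.mem_D.1 (A.w_mem i j).1
  have hw2 := A.mem_D.1 (A.w_mem i j).2
  set b := A.e (-(i + j)) * (A.e (-j) * c) with hb
  have hb2 : b ∈ A.D (-(i + j)) := (A.D _).mul_mem_right _ _ (A.e_mem _)
  have hb1 : b ∈ A.D (-j) := (A.D _).mul_mem_left _ _ ((A.D _).mul_mem_right _ _ (A.e_mem _))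
  have hk := key b hb1 hb2
  -- the image under `α j` of `1_{-j} 1_{-(i+j)}` is `1_j 1_{-i}`
  have him : ∀ k l : ℤ, A.act k (A.e l) = A.e k * A.e (k + l) := by
    intro k l
    have hm1 := A.act_mem k (A.e l)
    have hm2 := A.act_mem_add k (A.e_mem l)
    have : A.e k * A.e (k + l) ∈ {b | b ∈ A.D k ∧ b ∈ A.D (k + l)} :=
      ⟨(A.D _).mul_mem_right _ _ (A.e_mem _), (A.D _).mul_mem_left _ _ (A.e_mem _)⟩
    rw [← A.α_image] at this
    obtain ⟨a, ha, hae⟩ := this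
    simp only at hae
    rw [A.α_eq_act] at hae
    have h1 : A.act k (A.e l) * A.act k a = A.act k a := by
      rw [← A.act_mul, A.e_central, A.mem_D.1 ha]
    rw [hae, ← mul_assoc, A.mem_D.1 hm1, A.mem_D.1 hm2] at h1
    exact h1
  have e1 : A.act i (A.act j b) = A.act i (A.act j c) := by
    rw [hb, A.act_mul j, A.act_eq_mul_e, him]
    have : j + -(i + j) = -i := by ring
    rw [this, mul_assoc, A.e_central j, mul_assoc, A.mem_D.1 (A.act_mem j c), A.act_eq_mul_e]
  have e2 : A.w i j * A.act (i + j) b = A.w i j * A.act (i + j) c := by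
    rw [hb, A.act_eq_mul_e, A.act_mul, him]
    have : i + j + -j = i := by ring
    rw [this, ← mul_assoc, ← mul_assoc, hw2, hw1]
  rw [← e1, hk, e2]

theorem monoMul_assoc (i j k : ℤ) (a : A.D i) (b : A.D j) {c : R} (hc : c ∈ A.D k) (m : A.D (i + j))
    (hm : (m : R) = A.monoMul i j a b) :
    A.monoMul (i + j) k m c = A.monoMul i (j + k) a (A.monoMul j k b c) := by
  rw [monoMul_eq, hm, monoMul_eq, monoMul_eq, monoMul_eq]
  have hx1 : A.e (-i) * ((b : R) * A.act j c) ∈ A.D (-i) :=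
    (A.D _).mul_mem_right _ _ (A.e_mem _)
  have hx2 : A.e (-i) * ((b : R) * A.act j c) ∈ A.D j :=
    (A.D _).mul_mem_left _ _ ((A.D _).mul_mem_right _ _ b.2)
  have hx3 : A.e (-i) * ((b : R) * A.act j c) ∈ A.D (j + k) :=
    (A.D _).mul_mem_left _ _ ((A.D _).mul_mem_left _ _ (A.act_mem_add j hc))
  have := A.cocycle i j k _ hx1 hx2 hx3
  rw [A.α_eq_act, A.α_eq_act] at this
  simp only at this
  rw [A.act_eq_mul_e, mul_assoc (A.e (-i)), A.act_eq_mul_e] at this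
  rw [mul_assoc (a : R) _ (A.w i (j + k)), this, A.act_mul]
  rw [mul_assoc (A.act i _), A.act_comp]
  simp only [mul_assoc]

/-- The underlying additive group of `R[[x; α, w]]`: sequences `(a_n)` with `a_n ∈ D_n`. -/
def seriesSubgroup : AddSubgroup (ℕ → R) where
  carrier := {f | ∀ n : ℕ, f n ∈ A.D n}
  zero_mem' n := (A.D n).zero_mem
  add_mem' hf hg n := (A.D n).add_mem (hf n) (hg n)
  neg_mem' hf n := (A.D n).neg_mem (hf n)

/-- The twisted partial skew power series ring `R[[x; α, w]]`. The element with coefficients `a_n`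
is the series `∑ a_n x^n`. -/
def Series : Type _ := A.seriesSubgroup

instance : AddCommGroup A.Series := inferInstanceAs (AddCommGroup A.seriesSubgroup)

variable {A}

/-- The `n`-th coefficient, an element of `D_n`. -/
def Series.coeff (f : A.Series) (n : ℕ) : A.D n := ⟨f.1 n, f.2 n⟩

theorem Series.ext {f g : A.Series} (h : ∀ n, (f.coeff n : R) = g.coeff n) : f = g :=
  Subtype.ext (funext h)

/-- The series with the given coefficients. -/
def Series.mk (f : ℕ → R) (hf : ∀ n : ℕ, f n ∈ A.D n) : A.Series := ⟨f, hf⟩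

@[simp] theorem Series.coeff_mk (f : ℕ → R) (hf : ∀ n : ℕ, f n ∈ A.D n) (n : ℕ) :
    ((Series.mk f hf).coeff n : R) = f n := rfl

@[simp] theorem Series.coeff_add (f g : A.Series) (n : ℕ) :
    ((f + g).coeff n : R) = f.coeff n + g.coeff n := rfl

@[simp] theorem Series.coeff_zero (n : ℕ) : ((0 : A.Series).coeff n : R) = 0 := rfl

instance : Mul A.Series where
  mul f g := Series.mk
    (fun n => ∑ p ∈ Finset.HasAntidiagonal.antidiagonal n, A.monoMul p.1 p.2 (f.coeff p.1) (g.coeff p.2))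
    (fun n => sum_mem fun p hp => by
      have := A.monoMul_mem p.1 p.2 (f.coeff p.1) (g.coeff p.2)
      rwa [← Nat.cast_add, Finset.HasAntidiagonal.mem_antidiagonal.1 hp] at this)

instance : One A.Series where
  one := Series.mk (fun n => if n = 0 then 1 else 0) (fun n => by
    split_ifs with h
    · subst h
      simp only [Nat.cast_zero]
      rw [A.D_zero]
      trivial
    · exact (A.D n).zero_mem)

theorem Series.coeff_mul (f g : A.Series) (n : ℕ) : ((f * g).coeff n : R) =
    ∑ p ∈ Finset.HasAntidiagonal.antidiagonal n, A.monoMul p.1 p.2 (f.coeff p.1) (g.coeff p.2) := rfl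

theorem Series.coeff_one (n : ℕ) : ((1 : A.Series).coeff n : R) = if n = 0 then 1 else 0 := rfl

theorem act_zero_left (r : R) : A.act 0 r = r := by
  unfold act
  rw [A.α_zero]
  simp only [neg_zero, A.e_zero, one_mul]

theorem act_sum {ι : Type*} (i : ℤ) (s : Finset ι) (f : ι → R) :
    A.act i (∑ x ∈ s, f x) = ∑ x ∈ s, A.act i (f x) :=
  map_sum (⟨⟨A.act i, A.act_zero' i⟩, A.act_add i⟩ : R →+ R) f s

theorem act_one (i : ℤ) : A.act i 1 = A.e i := by
  obtain ⟨a, ha⟩ := (A.α i).surjective ⟨A.e i, A.e_mem i⟩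
  have h2 : A.act i a = A.e i := by rw [← A.α_eq_act, ha]
  have h1 : A.act i 1 * A.act i a = A.act i a := by rw [← A.act_mul, one_mul]
  rw [h2, A.mem_D.1 (A.act_mem i 1)] at h1
  exact h1

instance : Ring A.Series :=
  { (inferInstance : AddCommGroup A.Series) with
    mul := (· * ·)
    one := 1
    left_distrib := fun f g h => Series.ext fun n => by
      simp only [Series.coeff_mul, Series.coeff_add, monoMul_eq, act_add, mul_add, add_mul,
        Finset.sum_add_distrib]
    right_distrib := fun f g h => Series.ext fun n => by
      simp only [Series.coeff_mul, Series.coeff_add, monoMul_eq, add_mul, Finset.sum_add_distrib]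
    zero_mul := fun f => Series.ext fun n => by
      simp [Series.coeff_mul, monoMul_eq]
    mul_zero := fun f => Series.ext fun n => by
      simp [Series.coeff_mul, monoMul_eq, act_zero']
    one_mul := fun f => Series.ext fun n => by
      rw [Series.coeff_mul, Finset.sum_eq_single (0, n)]
      · rw [monoMul_eq, Series.coeff_one]
        simp only [Nat.cast_zero, if_true, one_mul, act_zero_left, A.w_left_zero]
        exact A.mem_D.1 (f.coeff n).2
      · rintro ⟨i, j⟩ hp hne
        have : i ≠ 0 := by
          rintro rfl
          apply hne
          simpa using hp
        rw [monoMul_eq, Series.coeff_one]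
        simp [this]
      · simp
    mul_one := fun f => Series.ext fun n => by
      rw [Series.coeff_mul, Finset.sum_eq_single (n, 0)]
      · rw [monoMul_eq, Series.coeff_one]
        simp only [Nat.cast_zero, if_true, A.w_right_zero, act_one]
        rw [A.mem_D.1 (f.coeff n).2, A.mem_D.1 (f.coeff n).2]
      · rintro ⟨i, j⟩ hp hne
        have : j ≠ 0 := by
          rintro rfl
          apply hne
          simpa using hp
        rw [monoMul_eq, Series.coeff_one]
        simp [this, act_zero']
      · simp
    mul_assoc := fun f g h => Series.ext fun n => by
      have hL : ((f * g * h).coeff n : R) = ∑ p ∈ Finset.HasAntidiagonal.antidiagonal n,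
          ∑ q ∈ Finset.HasAntidiagonal.antidiagonal p.1, A.monoMul q.1 (q.2 + p.2) (f.coeff q.1)
            (A.monoMul q.2 p.2 (g.coeff q.2) (h.coeff p.2)) := by
        rw [Series.coeff_mul]
        refine Finset.sum_congr rfl fun p hp => ?_
        rw [monoMul_eq, Series.coeff_mul, Finset.sum_mul, Finset.sum_mul]
        refine Finset.sum_congr rfl fun q hq => ?_
        have hq' := Finset.HasAntidiagonal.mem_antidiagonal.1 hq
        rw [← A.monoMul_assoc q.1 q.2 p.2 (f.coeff q.1) (g.coeff q.2) (h.coeff p.2).2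
          ⟨_, A.monoMul_mem q.1 q.2 (f.coeff q.1) (g.coeff q.2)⟩ rfl,
          A.monoMul_eq (q.1 + q.2), ← hq', Nat.cast_add]
      have hR : ((f * (g * h)).coeff n : R) = ∑ p ∈ Finset.HasAntidiagonal.antidiagonal n,
          ∑ q ∈ Finset.HasAntidiagonal.antidiagonal p.2, A.monoMul p.1 (q.1 + q.2) (f.coeff p.1)
            (A.monoMul q.1 q.2 (g.coeff q.1) (h.coeff q.2)) := by
        rw [Series.coeff_mul]
        refine Finset.sum_congr rfl fun p hp => ?_
        rw [monoMul_eq, Series.coeff_mul, act_sum, Finset.mul_sum, Finset.sum_mul]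
        refine Finset.sum_congr rfl fun q hq => ?_
        have hq' := Finset.HasAntidiagonal.mem_antidiagonal.1 hq
        rw [A.monoMul_eq p.1, ← hq', Nat.cast_add]
      rw [hL, hR]
      simp only [Finset.sum_sigma']
      apply Finset.sum_nbij' (fun ⟨⟨_i, j⟩, ⟨k, l⟩⟩ ↦ ⟨(k, l + j), (l, j)⟩)
        (fun ⟨⟨i, _j⟩, ⟨k, l⟩⟩ ↦ ⟨(i + k, l), (i, k)⟩)
      · rintro ⟨⟨i, j⟩, ⟨k, l⟩⟩ hp
        simp only [Finset.mem_sigma, Finset.HasAntidiagonal.mem_antidiagonal] at hp ⊢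
        obtain ⟨h1, h2⟩ := hp
        constructor
        · omega
        · trivial
      · rintro ⟨⟨i, j⟩, ⟨k, l⟩⟩ hp
        simp only [Finset.mem_sigma, Finset.HasAntidiagonal.mem_antidiagonal] at hp ⊢
        obtain ⟨h1, h2⟩ := hp
        constructor
        · omega
        · trivial
      · rintro ⟨⟨i, j⟩, ⟨k, l⟩⟩ hp
        simp only [Finset.mem_sigma, Finset.HasAntidiagonal.mem_antidiagonal] at hp
        obtain ⟨h1, rfl⟩ := hp
        rfl
      · rintro ⟨⟨i, j⟩, ⟨k, l⟩⟩ hp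
        simp only [Finset.mem_sigma, Finset.HasAntidiagonal.mem_antidiagonal] at hp
        obtain ⟨h1, rfl⟩ := hp
        rfl
      · rintro ⟨⟨i, j⟩, ⟨k, l⟩⟩ hp
        rfl }

end TwistedPartialAction

/-- A multiplier of a (possibly non-unital) ring `T`: a pair of additive maps, left multiplication
`a ↦ m a` and right multiplication `a ↦ a m`, compatible with the product of `T`. -/
@[ext] structure RingMultiplier (T : Type*) [NonUnitalRing T] where
  left : T →+ T
  right : T →+ T
  left_mul : ∀ a b, left (a * b) = left a * b
  right_mul : ∀ a b, right (a * b) = a * right b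
  central : ∀ a b, right a * b = a * left b

namespace RingMultiplier

variable {T : Type*} [NonUnitalRing T]

/-- Multipliers form a monoid: `(m n) a = m (n a)` and `a (m n) = (a m) n`. -/
instance : Monoid (RingMultiplier T) where
  mul m n :=
    { left := m.left.comp n.left
      right := n.right.comp m.right
      left_mul := fun a b => by simp [left_mul]
      right_mul := fun a b => by simp [right_mul]
      central := fun a b => by simp [central] }
  one :=
    { left := AddMonoidHom.id T
      right := AddMonoidHom.id T
      left_mul := fun _ _ => rfl
      right_mul := fun _ _ => rfl
      central := fun _ _ => rfl }
  mul_assoc _ _ _ := rfl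
  one_mul _ := rfl
  mul_one _ := rfl

theorem mul_left' (m n : RingMultiplier T) (a : T) : (m * n).left a = m.left (n.left a) := rfl
theorem mul_right' (m n : RingMultiplier T) (a : T) : (m * n).right a = n.right (m.right a) := rfl
theorem one_left' (a : T) : (1 : RingMultiplier T).left a = a := rfl
theorem one_right' (a : T) : (1 : RingMultiplier T).right a = a := rfl

end RingMultiplier

/-- A twisted global action of `ℤ` on a (possibly non-unital) ring `T`: automorphisms `β i` and
invertible multipliers `u i j`. -/
structure TwistedGlobalAction (T : Type*) [NonUnitalRing T] where
  β : ℤ → T ≃+* T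
  u : ℤ → ℤ → (RingMultiplier T)ˣ
  β_zero : ∀ a, β 0 a = a
  /-- `β i (β j a) = u i j * β (i + j) a * (u i j)⁻¹`. -/
  β_comp : ∀ i j a, β i (β j a) =
    (↑(u i j)⁻¹ : RingMultiplier T).right ((u i j : RingMultiplier T).left (β (i + j) a))
  u_right_zero : ∀ i, u i 0 = 1
  u_left_zero : ∀ i, u 0 i = 1
  /-- `β i (a * u j k) * u i (j + k) = β i a * u i j * u (i + j) k`. -/
  cocycle : ∀ i j k a,
    (u i (j + k) : RingMultiplier T).right (β i ((u j k : RingMultiplier T).right a)) =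
      (u (i + j) k : RingMultiplier T).right ((u i j : RingMultiplier T).right (β i a))

namespace TwistedGlobalAction

variable {T : Type*} [NonUnitalRing T] (B : TwistedGlobalAction T)

/-- The coefficient of `(a x^i) (b x^j)`, namely `β_i (β_i⁻¹ (a) b) u_{i,j}`. -/
def monoMul (i j : ℤ) (a b : T) : T :=
  (B.u i j : RingMultiplier T).right (B.β i ((B.β i).symm a * b))

theorem monoMul_eq (i j : ℤ) (a b : T) :
    B.monoMul i j a b = a * (B.u i j : RingMultiplier T).right (B.β i b) := by
  simp [monoMul, RingMultiplier.right_mul]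

theorem β_comp_u (i j : ℤ) (a : T) :
    (B.u i j : RingMultiplier T).right (B.β i (B.β j a)) =
      (B.u i j : RingMultiplier T).left (B.β (i + j) a) := by
  rw [B.β_comp, ← RingMultiplier.mul_right', Units.inv_mul, RingMultiplier.one_right']

theorem monoMul_assoc (i j k : ℤ) (a b c : T) :
    B.monoMul (i + j) k (B.monoMul i j a b) c = B.monoMul i (j + k) a (B.monoMul j k b c) := by
  simp only [monoMul_eq]
  rw [← RingMultiplier.right_mul _ b, B.cocycle, map_mul, RingMultiplier.right_mul,
    RingMultiplier.right_mul, mul_assoc, B.β_comp_u, RingMultiplier.central,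
    ← RingMultiplier.central (B.u i j : RingMultiplier T) (B.β i b), ← RingMultiplier.right_mul,
    RingMultiplier.central, RingMultiplier.right_mul]

/-- The twisted skew power series ring `T[[x; β, u]]`, of all series `∑ a_n x^n` with `a_n ∈ T`. -/
def Series (_B : TwistedGlobalAction T) : Type _ := ℕ → T

instance : AddCommGroup B.Series := inferInstanceAs (AddCommGroup (ℕ → T))

variable {B}

/-- The `n`-th coefficient. -/
def Series.coeff (f : B.Series) (n : ℕ) : T := f n

/-- The series with the given coefficients. -/
def Series.mk (f : ℕ → T) : B.Series := f

theorem Series.ext {f g : B.Series} (h : ∀ n, f.coeff n = g.coeff n) : f = g := funext h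

@[simp] theorem Series.coeff_mk (f : ℕ → T) (n : ℕ) : (Series.mk f : B.Series).coeff n = f n := rfl

@[simp] theorem Series.coeff_add (f g : B.Series) (n : ℕ) :
    (f + g).coeff n = f.coeff n + g.coeff n := rfl

@[simp] theorem Series.coeff_zero (n : ℕ) : (0 : B.Series).coeff n = 0 := rfl

instance : Mul B.Series where
  mul f g := Series.mk fun n =>
    ∑ p ∈ Finset.HasAntidiagonal.antidiagonal n, B.monoMul p.1 p.2 (f.coeff p.1) (g.coeff p.2)

theorem Series.coeff_mul (f g : B.Series) (n : ℕ) : (f * g).coeff n =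
    ∑ p ∈ Finset.HasAntidiagonal.antidiagonal n, B.monoMul p.1 p.2 (f.coeff p.1) (g.coeff p.2) := rfl

instance : NonUnitalRing B.Series :=
  { (inferInstance : AddCommGroup B.Series) with
    mul := (· * ·)
    left_distrib := fun f g h => Series.ext fun n => by
      simp only [Series.coeff_mul, Series.coeff_add, monoMul_eq, map_add, mul_add,
        Finset.sum_add_distrib]
    right_distrib := fun f g h => Series.ext fun n => by
      simp only [Series.coeff_mul, Series.coeff_add, monoMul_eq, add_mul, Finset.sum_add_distrib]
    zero_mul := fun f => Series.ext fun n => by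
      simp [Series.coeff_mul, monoMul_eq]
    mul_zero := fun f => Series.ext fun n => by
      simp [Series.coeff_mul, monoMul_eq]
    mul_assoc := fun f g h => Series.ext fun n => by
      have hL : (f * g * h).coeff n = ∑ p ∈ Finset.HasAntidiagonal.antidiagonal n,
          ∑ q ∈ Finset.HasAntidiagonal.antidiagonal p.1, B.monoMul q.1 (q.2 + p.2) (f.coeff q.1)
            (B.monoMul q.2 p.2 (g.coeff q.2) (h.coeff p.2)) := by
        rw [Series.coeff_mul]
        refine Finset.sum_congr rfl fun p hp => ?_
        rw [monoMul_eq, Series.coeff_mul, Finset.sum_mul]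
        refine Finset.sum_congr rfl fun q hq => ?_
        rw [← B.monoMul_assoc, B.monoMul_eq (q.1 + q.2), ← Finset.HasAntidiagonal.mem_antidiagonal.1 hq,
          Nat.cast_add]
      have hR : (f * (g * h)).coeff n = ∑ p ∈ Finset.HasAntidiagonal.antidiagonal n,
          ∑ q ∈ Finset.HasAntidiagonal.antidiagonal p.2, B.monoMul p.1 (q.1 + q.2) (f.coeff p.1)
            (B.monoMul q.1 q.2 (g.coeff q.1) (h.coeff q.2)) := by
        rw [Series.coeff_mul]
        refine Finset.sum_congr rfl fun p hp => ?_
        rw [monoMul_eq, Series.coeff_mul, map_sum, map_sum, Finset.mul_sum]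
        refine Finset.sum_congr rfl fun q hq => ?_
        rw [B.monoMul_eq p.1, ← Finset.HasAntidiagonal.mem_antidiagonal.1 hq, Nat.cast_add]
      rw [hL, hR]
      simp only [Finset.sum_sigma']
      apply Finset.sum_nbij' (fun ⟨⟨_i, j⟩, ⟨k, l⟩⟩ ↦ ⟨(k, l + j), (l, j)⟩)
        (fun ⟨⟨i, _j⟩, ⟨k, l⟩⟩ ↦ ⟨(i + k, l), (i, k)⟩)
      · rintro ⟨⟨i, j⟩, ⟨k, l⟩⟩ hp
        simp only [Finset.mem_sigma, Finset.HasAntidiagonal.mem_antidiagonal] at hp ⊢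
        obtain ⟨h1, h2⟩ := hp
        constructor
        · omega
        · trivial
      · rintro ⟨⟨i, j⟩, ⟨k, l⟩⟩ hp
        simp only [Finset.mem_sigma, Finset.HasAntidiagonal.mem_antidiagonal] at hp ⊢
        obtain ⟨h1, h2⟩ := hp
        constructor
        · omega
        · trivial
      · rintro ⟨⟨i, j⟩, ⟨k, l⟩⟩ hp
        simp only [Finset.mem_sigma, Finset.HasAntidiagonal.mem_antidiagonal] at hp
        obtain ⟨h1, rfl⟩ := hp
        rfl
      · rintro ⟨⟨i, j⟩, ⟨k, l⟩⟩ hp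
        simp only [Finset.mem_sigma, Finset.HasAntidiagonal.mem_antidiagonal] at hp
        obtain ⟨h1, rfl⟩ := hp
        rfl
      · rintro ⟨⟨i, j⟩, ⟨k, l⟩⟩ hp
        rfl }

/-- The constant series `t x^0`. -/
def Series.const (B : TwistedGlobalAction T) (t : T) : B.Series :=
  Series.mk fun n => if n = 0 then t else 0

end TwistedGlobalAction

/-- The twisted global action `B` of `ℤ` on `T`, with the map `φ : R → T`, is an enveloping action of
the unital twisted partial action `A` of `ℤ` on `R`. -/
structure IsEnvelopingAction {R T : Type*} [Ring R] [NonUnitalRing T] (A : TwistedPartialAction R)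
    (B : TwistedGlobalAction T) (φ : R →ₙ+* T) : Prop where
  injective : Function.Injective φ
  mul_mem_range_left : ∀ t r, t * φ r ∈ Set.range φ
  mul_mem_range_right : ∀ t r, φ r * t ∈ Set.range φ
  sum_eq_top : ⨆ i : ℤ, (φ : R →+ T).range.map (B.β i : T →+ T) = ⊤
  image_D : ∀ i, φ '' (A.D i : Set R) = Set.range φ ∩ B.β i '' Set.range φ
  map_α : ∀ i (a : A.D (-i)), φ (A.α i a) = B.β i (φ a)
  map_mul_w : ∀ i j a, a ∈ A.D i → a ∈ A.D (i + j) →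
    φ (a * A.w i j) = (B.u i j : RingMultiplier T).right (φ a)
  map_w_mul : ∀ i j a, a ∈ A.D i → a ∈ A.D (i + j) →
    φ (A.w i j * a) = (B.u i j : RingMultiplier T).left (φ a)

namespace IsEnvelopingAction

variable {R T : Type*} [Ring R] [NonUnitalRing T] {A : TwistedPartialAction R}
  {B : TwistedGlobalAction T} {φ : R →ₙ+* T}

theorem map_monoMul (h : IsEnvelopingAction A B φ) {i j : ℤ} (a : A.D i) (b : A.D j) :
    φ (A.monoMul i j a b) = B.monoMul i j (φ a) (φ b) := by
  unfold TwistedPartialAction.monoMul TwistedGlobalAction.monoMul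
  have h1 : (B.β i).symm (φ a) = φ ((A.α i).symm a) := by
    rw [RingEquiv.symm_apply_eq, ← h.map_α, RingEquiv.apply_symm_apply]
  rw [h.map_mul_w i j _ (SetLike.coe_mem _) (A.α_mem ((A.D j).mul_mem_left _ _ b.2)), h.map_α, h1,
    map_mul]

/-- The inclusion `R[[x; α, w]] → T[[x; β, u]]`, `∑ a_n x^n ↦ ∑ φ(a_n) x^n`. -/
def seriesMap (h : IsEnvelopingAction A B φ) : A.Series →ₙ+* B.Series where
  toFun f := .mk fun n => φ (f.coeff n)
  map_zero' := TwistedGlobalAction.Series.ext fun n => by simp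
  map_add' f g := TwistedGlobalAction.Series.ext fun n => by simp
  map_mul' f g := TwistedGlobalAction.Series.ext fun n => by
    simp [TwistedGlobalAction.Series.coeff_mul, TwistedPartialAction.Series.coeff_mul,
      h.map_monoMul]

end IsEnvelopingAction

/-- A prime ideal of a (possibly non-commutative and non-unital) ring: a proper two-sided ideal `P`
such that `I J ⊆ P` implies `I ⊆ P` or `J ⊆ P` for all two-sided ideals `I`, `J`. -/
def TwoSidedIdeal.IsPrimeIdeal {S : Type*} [NonUnitalRing S] (P : TwoSidedIdeal S) : Prop :=
  P ≠ ⊤ ∧ ∀ I J : TwoSidedIdeal S, (∀ a ∈ I, ∀ b ∈ J, a * b ∈ P) → I ≤ P ∨ J ≤ P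

/-!
Let `S = T[[x; β, u]]` and let `e = φ(1) x⁰`, an idempotent of `S`. The `n`-th coefficient of
`e (∑ tₙ xⁿ) e` is `φ(1) tₙ βₙ(φ(1))`, which lies in `φ(R) ∩ βₙ(φ(R)) = φ(Dₙ)` because `φ(R)` is an
ideal. Hence `R[[x; α, w]]` is the corner `e S e`. Since every `φ(r) x⁰` is a multiple of `e`, an
ideal of `S` contains `R` if and only if it contains `e`.

For any idempotent `e` of a ring `S`, the primes of `S` not containing `e` correspond to the primes
of `e S e` by contraction: the prime over `P` is `{s | e S s S e ⊆ P}`. That a prime `P'` without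
`e` is determined by its contraction follows from the elementwise form of primality:
`e S s S e ⊆ P'` forces `s ∈ P'`.
-/

section PrimeIdeals

variable {S : Type*} [NonUnitalRing S] {P : TwoSidedIdeal S}

theorem mul_mem_of_mem_twoSidedIdeal_span {X : Set S} {J : TwoSidedIdeal S}
    (hXJ : ∀ x ∈ X, ∀ y ∈ J, x * y ∈ P) {x y : S} (hx : x ∈ TwoSidedIdeal.span X) (hy : y ∈ J) :
    x * y ∈ P := by
  induction hx using TwoSidedIdeal.span_induction generalizing y with
  | mem x hx => exact hXJ x hx y hy
  | zero => simpa only [zero_mul] using P.zero_mem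
  | add x z _ _ ihx ihz => simpa only [add_mul] using P.add_mem (ihx hy) (ihz hy)
  | neg x _ ih => simpa only [neg_mul] using P.neg_mem (ih hy)
  | left_absorb a x _ ih => simpa only [mul_assoc] using P.mul_mem_left a _ (ih hy)
  | right_absorb b x _ ih => simpa only [mul_assoc] using ih (J.mul_mem_left b y hy)

theorem mul_mul_mem_of_mem_twoSidedIdeal_span_left {X Y : Set S}
    (hXY : ∀ x ∈ X, ∀ s, ∀ y ∈ Y, x * s * y ∈ P) {x y : S} (hx : x ∈ TwoSidedIdeal.span X) (s : S)
    (hy : y ∈ Y) : x * s * y ∈ P := by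
  induction hx using TwoSidedIdeal.span_induction generalizing s with
  | mem x hx => exact hXY x hx s y hy
  | zero => simpa only [zero_mul] using P.zero_mem
  | add x z _ _ ihx ihz => simpa only [add_mul] using P.add_mem (ihx s) (ihz s)
  | neg x _ ih => simpa only [neg_mul] using P.neg_mem (ih s)
  | left_absorb a x _ ih => simpa only [mul_assoc] using P.mul_mem_left a _ (ih s)
  | right_absorb b x _ ih => simpa only [mul_assoc] using ih (b * s)

theorem mul_mul_mem_of_mem_twoSidedIdeal_span {X Y : Set S}
    (hXY : ∀ x ∈ X, ∀ s, ∀ y ∈ Y, x * s * y ∈ P) {x y : S} (hx : x ∈ TwoSidedIdeal.span X) (s : S)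
    (hy : y ∈ TwoSidedIdeal.span Y) : x * s * y ∈ P := by
  induction hy using TwoSidedIdeal.span_induction generalizing s with
  | mem y hy => exact mul_mul_mem_of_mem_twoSidedIdeal_span_left hXY hx s hy
  | zero => simpa only [mul_zero] using P.zero_mem
  | add y z _ _ ihy ihz => simpa only [mul_add] using P.add_mem (ihy s) (ihz s)
  | neg y _ ih => simpa only [mul_neg] using P.neg_mem (ih s)
  | left_absorb a y _ ih => simpa only [mul_assoc] using ih (s * a)
  | right_absorb b y _ ih => simpa only [mul_assoc] using P.mul_mem_right _ b (ih s)

theorem le_or_le_of_isPrimeIdeal_of_mul_mul_mem (hP : P.IsPrimeIdeal) {I J : TwoSidedIdeal S}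
    (hIJ : ∀ a ∈ I, ∀ s, ∀ b ∈ J, a * s * b ∈ P) : I ≤ P ∨ J ≤ P := by
  let IS : TwoSidedIdeal S := TwoSidedIdeal.span {x | ∃ a ∈ I, ∃ s, a * s = x}
  have hISJ : ∀ x ∈ IS, ∀ b ∈ J, x * b ∈ P := fun x hx b hb =>
    mul_mem_of_mem_twoSidedIdeal_span (by rintro _ ⟨a, ha, s, rfl⟩; exact hIJ a ha s) hx hb
  refine (hP.2 IS J hISJ).imp_left fun hISP => ?_
  have hI_top : ∀ a ∈ I, ∀ s ∈ (⊤ : TwoSidedIdeal S), a * s ∈ P := fun a ha s _ =>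
    hISP (TwoSidedIdeal.subset_span ⟨a, ha, s, rfl⟩)
  exact (hP.2 I ⊤ hI_top).resolve_right fun h => hP.1 (top_le_iff.1 h)

theorem mem_or_mem_of_isPrimeIdeal_of_mul_mul_mem (hP : P.IsPrimeIdeal) {a b : S}
    (hab : ∀ s, a * s * b ∈ P) : a ∈ P ∨ b ∈ P := by
  have hspan : ∀ x ∈ TwoSidedIdeal.span {a}, ∀ s, ∀ y ∈ TwoSidedIdeal.span {b}, x * s * y ∈ P :=
    fun x hx s y hy =>
      mul_mul_mem_of_mem_twoSidedIdeal_span (by rintro _ rfl s _ rfl; exact hab s) hx s hy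
  exact (le_or_le_of_isPrimeIdeal_of_mul_mul_mem hP hspan).imp
    (fun h => h (TwoSidedIdeal.subset_span rfl)) (fun h => h (TwoSidedIdeal.subset_span rfl))

end PrimeIdeals

section Corner

variable {S C : Type*} [NonUnitalRing S] [Ring C] {ι : C →ₙ+* S}

/-- The extension to `S` of an ideal `P` of a corner `ι : C → S` with idempotent `e = ι 1`, namely
`{s | e S s S e ⊆ ι(P)}`: the largest ideal of `S` with contraction `P`. -/
def cornerExtension (ι : C →ₙ+* S) (P : TwoSidedIdeal C) : TwoSidedIdeal S :=
  let ιP : AddSubgroup S := (AddSubgroup.ofClass P).map (ι : C →+ S)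
  .mk' {s | ∀ x y, ι 1 * (x * s * y) * ι 1 ∈ ιP}
    (fun x y => by simpa only [mul_zero, zero_mul] using ιP.zero_mem)
    (fun hs ht x y => by simpa only [mul_add, add_mul] using ιP.add_mem (hs x y) (ht x y))
    (fun hs x y => by simpa only [mul_neg, neg_mul] using ιP.neg_mem (hs x y))
    (fun {t _} hs x y => by simpa only [mul_assoc] using hs (x * t) y)
    (fun {_ t} hs x y => by simpa only [mul_assoc] using hs x (t * y))

theorem mem_cornerExtension {P : TwoSidedIdeal C} {s : S} :
    s ∈ cornerExtension ι P ↔ ∀ x y, ∃ c ∈ P, ι c = ι 1 * (x * s * y) * ι 1 := by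
  rw [cornerExtension, TwoSidedIdeal.mem_mk']
  rfl

theorem exists_mem_comap_eq_corner (hcorner : ∀ s, ι 1 * s * ι 1 ∈ Set.range ι)
    {I : TwoSidedIdeal S} {s : S} (hs : s ∈ I) : ∃ c ∈ I.comap ι, ι c = ι 1 * s * ι 1 := by
  obtain ⟨c, hc⟩ := hcorner s
  refine ⟨c, ?_, hc⟩
  rw [TwoSidedIdeal.mem_comap, hc]
  exact I.mul_mem_right _ _ (I.mul_mem_left _ _ hs)

theorem le_cornerExtension_of_comap_le (hcorner : ∀ s, ι 1 * s * ι 1 ∈ Set.range ι)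
    {I : TwoSidedIdeal S} {P : TwoSidedIdeal C} (hIP : I.comap ι ≤ P) :
    I ≤ cornerExtension ι P := fun s hs => mem_cornerExtension.2 fun x y => by
  obtain ⟨c, hcI, hc⟩ :=
    exists_mem_comap_eq_corner hcorner (I.mul_mem_right _ y (I.mul_mem_left x s hs))
  exact ⟨c, hIP hcI, hc⟩

theorem comap_cornerExtension (hι : Function.Injective ι)
    (hcorner : ∀ s, ι 1 * s * ι 1 ∈ Set.range ι) (P : TwoSidedIdeal C) :
    (cornerExtension ι P).comap ι = P := by
  ext c
  rw [TwoSidedIdeal.mem_comap, mem_cornerExtension]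
  constructor
  · intro h
    obtain ⟨p, hpP, hp⟩ := h (ι 1) (ι 1)
    simp only [← map_mul, one_mul, mul_one] at hp
    exact hι hp ▸ hpP
  · intro hc x y
    obtain ⟨a, ha⟩ := hcorner x
    obtain ⟨b, hb⟩ := hcorner y
    refine ⟨a * c * b, P.mul_mem_right _ _ (P.mul_mem_left _ _ hc), ?_⟩
    calc ι (a * c * b) = ι 1 * x * (ι 1 * ι c * ι 1) * y * ι 1 := by
          simp only [map_mul, ha, hb, mul_assoc]
      _ = ι 1 * (x * ι c * y) * ι 1 := by
          simp only [← map_mul, one_mul, mul_one, mul_assoc]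

theorem isPrimeIdeal_cornerExtension (hι : Function.Injective ι)
    (hcorner : ∀ s, ι 1 * s * ι 1 ∈ Set.range ι) {P : TwoSidedIdeal C} (hP : P.IsPrimeIdeal) :
    (cornerExtension ι P).IsPrimeIdeal := by
  have hcomap := comap_cornerExtension hι hcorner P
  refine ⟨fun htop => hP.1 ?_, fun I J hIJ => ?_⟩
  · rw [← hcomap, htop]
    rfl
  · have hprod : ∀ a ∈ I.comap ι, ∀ b ∈ J.comap ι, a * b ∈ P := fun a ha b hb => by
      rw [← hcomap, TwoSidedIdeal.mem_comap, map_mul]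
      exact hIJ _ ((TwoSidedIdeal.mem_comap ι).1 ha) _ ((TwoSidedIdeal.mem_comap ι).1 hb)
    exact (hP.2 _ _ hprod).imp (le_cornerExtension_of_comap_le hcorner)
      (le_cornerExtension_of_comap_le hcorner)

theorem isPrimeIdeal_comap_of_corner (hcorner : ∀ s, ι 1 * s * ι 1 ∈ Set.range ι)
    {P : TwoSidedIdeal S} (hP : P.IsPrimeIdeal) (hone : ι 1 ∉ P) : (P.comap ι).IsPrimeIdeal := by
  refine ⟨fun htop => hone ?_, fun I J hIJ => ?_⟩
  · rwa [← TwoSidedIdeal.one_mem_iff, TwoSidedIdeal.mem_comap] at htop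
  · by_contra! hnot
    obtain ⟨a, haI, haP⟩ := SetLike.not_le_iff_exists.1 hnot.1
    obtain ⟨b, hbJ, hbP⟩ := SetLike.not_le_iff_exists.1 hnot.2
    rw [TwoSidedIdeal.mem_comap] at haP hbP
    refine (mem_or_mem_of_isPrimeIdeal_of_mul_mul_mem hP fun s => ?_).elim haP hbP
    obtain ⟨c, hc⟩ := hcorner s
    have hacb : ι a * s * ι b = ι (a * c * b) :=
      calc ι a * s * ι b = ι (a * 1) * s * ι (1 * b) := by rw [mul_one, one_mul]
        _ = ι (a * c * b) := by simp only [map_mul, hc, mul_assoc]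
    rw [hacb]
    exact (TwoSidedIdeal.mem_comap ι).1 (hIJ _ (I.mul_mem_right a c haI) _ hbJ)

theorem le_of_comap_le_comap_of_corner (hcorner : ∀ s, ι 1 * s * ι 1 ∈ Set.range ι)
    {I P : TwoSidedIdeal S} (hP : P.IsPrimeIdeal) (hone : ι 1 ∉ P)
    (hIP : I.comap ι ≤ P.comap ι) : I ≤ P := fun s hs => by
  have hsandwich : ∀ x y, ι 1 * x * (s * y * ι 1) ∈ P := fun x y => by
    obtain ⟨c, hcI, hc⟩ :=
      exists_mem_comap_eq_corner hcorner (I.mul_mem_right _ y (I.mul_mem_left x s hs))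
    have hcP : ι c ∈ P := (TwoSidedIdeal.mem_comap ι).1 (hIP hcI)
    simpa only [hc, mul_assoc] using hcP
  have hright : ∀ y, s * y * ι 1 ∈ P := fun y =>
    (mem_or_mem_of_isPrimeIdeal_of_mul_mul_mem hP (hsandwich · y)).resolve_left hone
  exact (mem_or_mem_of_isPrimeIdeal_of_mul_mul_mem hP hright).resolve_right hone

theorem bijOn_comap_isPrimeIdeal_of_corner (hι : Function.Injective ι)
    (hcorner : ∀ s, ι 1 * s * ι 1 ∈ Set.range ι) :
    Set.BijOn (fun P : TwoSidedIdeal S => P.comap ι) {P | P.IsPrimeIdeal ∧ ι 1 ∉ P}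
      {P : TwoSidedIdeal C | P.IsPrimeIdeal} := by
  refine ⟨fun P hP => isPrimeIdeal_comap_of_corner hcorner hP.1 hP.2,
    fun P hP Q hQ hPQ => le_antisymm
      (le_of_comap_le_comap_of_corner hcorner hQ.1 hQ.2 hPQ.le)
      (le_of_comap_le_comap_of_corner hcorner hP.1 hP.2 hPQ.ge),
    fun P hP => ?_⟩
  have hcomap := comap_cornerExtension hι hcorner P
  refine ⟨cornerExtension ι P, ⟨isPrimeIdeal_cornerExtension hι hcorner hP, fun hone => hP.1 ?_⟩,
    hcomap⟩
  rwa [← TwoSidedIdeal.one_mem_iff, ← hcomap, TwoSidedIdeal.mem_comap]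

end Corner

namespace TwistedGlobalAction

variable {T : Type*} [NonUnitalRing T] {B : TwistedGlobalAction T}

theorem Series.coeff_const (t : T) (n : ℕ) :
    (Series.const B t).coeff n = if n = 0 then t else 0 := rfl

theorem Series.coeff_const_mul (t : T) (f : B.Series) (n : ℕ) :
    (Series.const B t * f).coeff n = t * f.coeff n := by
  rw [coeff_mul, Finset.sum_eq_single (0, n)]
  · simp [monoMul_eq, coeff_const, B.u_left_zero, B.β_zero, RingMultiplier.one_right']
  · rintro ⟨i, j⟩ hij hne
    have hi : i ≠ 0 := by
      rintro rfl
      exact hne (by simpa using hij)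
    simp [monoMul_eq, coeff_const, hi]
  · simp

theorem Series.coeff_mul_const (f : B.Series) (t : T) (n : ℕ) :
    (f * Series.const B t).coeff n = f.coeff n * B.β n t := by
  rw [coeff_mul, Finset.sum_eq_single (n, 0)]
  · simp [monoMul_eq, coeff_const, B.u_right_zero, RingMultiplier.one_right']
  · rintro ⟨i, j⟩ hij hne
    have hj : j ≠ 0 := by
      rintro rfl
      exact hne (by simpa using hij)
    simp [monoMul_eq, coeff_const, hj]
  · simp

theorem Series.const_mul_const (s t : T) :
    Series.const B s * Series.const B t = Series.const B (s * t) :=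
  Series.ext fun n => by simp only [coeff_const_mul, coeff_const, mul_ite, mul_zero]

end TwistedGlobalAction

theorem mul_mul_mem_range_inter_image_range {R T : Type*} [NonUnitalRing R] [NonUnitalRing T]
    {φ : R →ₙ+* T} (hleft : ∀ t r, t * φ r ∈ Set.range φ) (hright : ∀ t r, φ r * t ∈ Set.range φ)
    (σ : T ≃+* T) (r r' : R) (t : T) :
    φ r * t * σ (φ r') ∈ Set.range φ ∩ σ '' Set.range φ := by
  constructor
  · rw [mul_assoc]
    exact hright _ r
  · exact ⟨_, hleft (σ.symm (φ r * t)) r', by rw [map_mul, σ.apply_symm_apply]⟩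

section SeriesEmbedding

open TwistedGlobalAction (Series.const)

variable {R T : Type*} [Ring R] [NonUnitalRing T] {A : TwistedPartialAction R}
  {B : TwistedGlobalAction T} {φ : R →ₙ+* T} {ι : A.Series →ₙ+* B.Series}

theorem seriesEmbedding_injective (hφ : Function.Injective φ)
    (hι : ∀ f n, (ι f).coeff n = φ (f.coeff n)) : Function.Injective ι := fun f g hfg =>
  TwistedPartialAction.Series.ext fun n => hφ (by rw [← hι, hfg, hι])

theorem seriesEmbedding_one (hι : ∀ f n, (ι f).coeff n = φ (f.coeff n)) :
    ι 1 = Series.const B (φ 1) :=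
  TwistedGlobalAction.Series.ext fun n => by
    rw [hι, TwistedPartialAction.Series.coeff_one, apply_ite φ, map_zero,
      TwistedGlobalAction.Series.coeff_const]

theorem coeff_seriesEmbedding_one_mul_mul_one (hι : ∀ f n, (ι f).coeff n = φ (f.coeff n))
    (s : B.Series) (n : ℕ) : (ι 1 * s * ι 1).coeff n = φ 1 * s.coeff n * B.β n (φ 1) := by
  rw [seriesEmbedding_one hι, TwistedGlobalAction.Series.coeff_mul_const,
    TwistedGlobalAction.Series.coeff_const_mul]

theorem seriesEmbedding_one_mul_mul_one_mem_range (hleft : ∀ t r, t * φ r ∈ Set.range φ)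
    (hright : ∀ t r, φ r * t ∈ Set.range φ)
    (hD : ∀ n : ℕ, Set.range φ ∩ B.β n '' Set.range φ ⊆ φ '' (A.D n : Set R))
    (hι : ∀ f n, (ι f).coeff n = φ (f.coeff n)) (s : B.Series) :
    ι 1 * s * ι 1 ∈ Set.range ι := by
  have hcoeff : ∀ n : ℕ, ∃ a ∈ A.D n, φ a = φ 1 * s.coeff n * B.β n (φ 1) := fun n =>
    hD n (mul_mul_mem_range_inter_image_range hleft hright (B.β n) 1 1 (s.coeff n))
  choose a ha hφa using hcoeff
  refine ⟨.mk a ha, TwistedGlobalAction.Series.ext fun n => ?_⟩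
  rw [hι, TwistedPartialAction.Series.coeff_mk, hφa, coeff_seriesEmbedding_one_mul_mul_one hι]

theorem forall_const_mem_iff_seriesEmbedding_one_mem
    (hι : ∀ f n, (ι f).coeff n = φ (f.coeff n)) (P : TwoSidedIdeal B.Series) :
    (∀ r, Series.const B (φ r) ∈ P) ↔ ι 1 ∈ P := by
  rw [seriesEmbedding_one hι]
  refine ⟨fun h => h 1, fun h r => ?_⟩
  rw [← mul_one r, map_mul, ← TwistedGlobalAction.Series.const_mul_const]
  exact P.mul_mem_left _ _ h

end SeriesEmbedding

theorem mainTheorem11_general {R T : Type*} [Ring R] [NonUnitalRing T] {A : TwistedPartialAction R}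
    {B : TwistedGlobalAction T} {φ : R →ₙ+* T} (hφ : Function.Injective φ)
    (hleft : ∀ t r, t * φ r ∈ Set.range φ) (hright : ∀ t r, φ r * t ∈ Set.range φ)
    (hD : ∀ n : ℕ, Set.range φ ∩ B.β n '' Set.range φ ⊆ φ '' (A.D n : Set R))
    {ι : A.Series →ₙ+* B.Series} (hι : ∀ f n, (ι f).coeff n = φ (f.coeff n)) :
    Set.BijOn (fun P' : TwoSidedIdeal B.Series => P'.comap ι)
      {P' | P'.IsPrimeIdeal ∧ ¬ ∀ r : R, TwistedGlobalAction.Series.const B (φ r) ∈ P'}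
      {P : TwoSidedIdeal A.Series | P.IsPrimeIdeal} := by
  simp only [forall_const_mem_iff_seriesEmbedding_one_mem hι]
  exact bijOn_comap_isPrimeIdeal_of_corner (seriesEmbedding_injective hφ hι)
    (seriesEmbedding_one_mul_mul_one_mem_range hleft hright hD hι)

theorem mainTheorem11 {R T : Type*} [Ring R] [NonUnitalRing T] (A : TwistedPartialAction R)
    (B : TwistedGlobalAction T) (φ : R →ₙ+* T) (h : IsEnvelopingAction A B φ) :
    Set.BijOn (fun P' : TwoSidedIdeal B.Series => P'.comap h.seriesMap)
      {P' | P'.IsPrimeIdeal ∧ ¬ ∀ r : R, TwistedGlobalAction.Series.const B (φ r) ∈ P'}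
      {P : TwoSidedIdeal A.Series | P.IsPrimeIdeal} :=
  mainTheorem11_general h.injective h.mul_mem_range_left h.mul_mem_range_right
    (fun n => (h.image_D n).ge) fun _ _ => rfl
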